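/- **Model.** A circuit is a finite set of gates on named registers, each register classical or quantum. A gate is a permutation of the values of classical registers, a unitary on quantum registers, or a measurement whose outcome is stored in a fresh classical register. A gate can be controlled by classical bits, and it can be conditioned on an activation register, in which case it comes after the gates that set this register. The gates of a circuit are partially ordered, causally, in a way that can depend on the values of its own control bits; for all such values, two gates that access a same register (a control register, or a target register of an active gate) are ordered. $A+B$ is the union of the sets of gates and of the order relations. A protocol is a finite union of role-circuits, which share channel registers. Each channel has a type that says how the environment can access it; the input/output channels are shared with the environment. A corruptible role-circuit $r$ has a corruption bit $C_r$, and its gates do nothing when $C_r=1$. A valid environment $E$ for $P$ consists of gates on its own registers, among them an output bit $Z$, that can also use the input/output channels and corruption bits of $P$, access the other channels as their types permit, and access all registers of a corruptible $r$, and communicate in its name, with gates that are active only if $C_r=1$. It also chooses the order of the communication gates of $P$, and $E+P$ must be a circuit. An ideal protocol $I(P)$ associated with $P$ is a protocol with its own internal registers. It uses the input/output channels and the corruption bits of $P$, and for every role-circuit $r$ of $P$ with input/output it has one, with the same corruption bit, that uses the input/output channels of $r$. A valid simulator $S$ is a set of gates that supplies the registers and channels of $P$ to $E$, accesses $I(P)$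 as an adversary (in particular, its input/output only in the name of corrupted circuits), and does not change corruption bits; $E+I(P)+S$ must be a circuit. For $\varepsilon=\varepsilon(n,E)$, where $n$ is the security parameter, $P$ *$\varepsilon$-securely realizes* $I(P)$ if for every $n$ and every valid environment $E$ for $P$ there is a valid simulator $S$ with $$\bigl|\Pr(Z_{E+P}=0)-\Pr(Z_{E+I(P)+S}=0)\bigr|\le\varepsilon(n,E).$$ **Theorem.** Let $P$ be a protocol with a finite tree of sub-protocols $Q=M(Q)+\sum_{R\in\mathcal C(Q)}R$, where $M(Q)$ is the main module of $Q$, $\mathcal C(Q)$ is the set of sub-protocols that it calls, and distinct modules communicate only through the input/output channels between a caller and the modules it calls. Let $I(Q)$ be an ideal protocol associated with $Q$, and let $\widetilde Q=M(Q)+\sum_{R\in\mathcal C(Q)}I(R)$. (The protocol, the tree and the $I(Q)$ may depend on $n$. Internal registers and gates of distinct modules and ideal protocols have distinct names, reserved for them, except that a gate of $I(Q)$ may take the name, and so the place in the order, of a gate of $M(Q)$.) Suppose that, for every sub-protocol $Q$ of $P$ (including $P$ itself), $\widetilde Q$ $\varepsilon_{\widetilde Q}$-securely realizes $I(Q)$,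 where $\varepsilon_{\widetilde Q}=\varepsilon_{\widetilde Q}(n,E)$ may depend on the environment. Then there are simulators $S_Q(n,E)$, as functions of the environment, that witness this for all $Q$. Moreover, fix any such choice and any bottom-up traversal of the tree. For a valid environment $E$ for $P$, define $E(\widetilde Q)$ recursively along the traversal as $$E(\widetilde Q)=E+\sum_{R>Q}M(R)+\sum_{R}I(R)+\sum_{R<Q}S_R(n,E(\widetilde R)),$$ where $<$ is the traversal order and the middle sum is over the $R<Q$ whose caller is visited after $Q$. Then $P$ $\varepsilon_P$-securely realizes $I(P)$, with $$\varepsilon_P(n,E)=\sum_{Q}\varepsilon_{\widetilde Q}(n,E(\widetilde Q)).$$ -/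

import Mathlib

/-! ### Registers, configurations and gates -/

/-- A register: a name, its nature (classical or quantum), and its set of basis values
`{0, …, top}`. The registers with a given name of different nature or size are distinct. -/
structure Reg where
  id : ℕ
  classical : Bool
  top : ℕ
deriving DecidableEq

/-- The basis values of a register. -/
abbrev Reg.Val (v : Reg) : Type := Fin (v.top + 1)

/-- A classical bit. -/
def Reg.IsBit (v : Reg) : Prop := v.classical = true ∧ v.top = 1

/-- Computational basis states of all registers together. -/
abbrev Config : Type := (v : Reg) → v.Val

/-- Computational basis states of the registers in a finite set. -/
abbrev LocalConfig (s : Finset Reg) : Type := (v : s) → v.1.Val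

/-- State vectors (the reachable ones have finite support). -/
abbrev QState : Type := Config → ℂ

/-- All registers initially contain `0`; for a corruption register this means "not corrupted", for
an activation register it means `SLEEP`. -/
noncomputable def initialState : QState :=
  open Classical in fun b => if b = fun _ => 0 then 1 else 0

/-- Overwrite a configuration on a finite set of registers. -/
def Config.patch {s : Finset Reg} (b : Config) (y : LocalConfig s) : Config :=
  fun v => if h : v ∈ s then y ⟨v, h⟩ else b v

/-- A (controlled) gate. Its controlled part is the unitary `U` on the target registers `tgt`; it is
active when every control bit `c` with `(c, a) ∈ ctrl` has the value `a`, and otherwise the gate is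
the identity. A gate is of one of three types:
* a classical gate: a permutation of the values of classical registers;
* a quantum gate: a unitary on quantum registers (classical ones can only be control bits);
* a measurement: a unitary on quantum registers and one classical register `X`, `outcome = some X`.
  As `X` is fresh (see `Component.IsCircuit`), the gate maps `ψ ⊗ |0⟩` to `∑ x, K x ψ ⊗ |x⟩` with
  `∑ x, (K x)ᴴ (K x) = 1`.
If `wake = some a`, then `a` is the activation register of the gate, which is only executed once `a`
contains `1` (`WAKE-UP`). -/
structure Gate where
  id : ℕ
  ctrl : Finset (Reg × ℕ)
  tgt : Finset Reg
  wake : Option Reg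
  outcome : Option Reg
  U : Matrix (LocalConfig tgt) (LocalConfig tgt) ℂ
  unitary : U ∈ Matrix.unitaryGroup (LocalConfig tgt) ℂ
  ctrl_bit : ∀ c ∈ ctrl, c.1.IsBit ∧ c.1 ∉ tgt
  wake_ctrl : ∀ a, wake = some a → (a, 1) ∈ ctrl
  unmeasured : outcome = none →
    ((∀ v ∈ tgt, v.classical = true) ∧
      ∃ σ : Equiv.Perm (LocalConfig tgt), U = σ.permMatrix ℂ) ∨
    (∀ v ∈ tgt, v.classical = false)
  measured : ∀ X, outcome = some X →
    X ∈ tgt ∧ X.classical = true ∧ ∀ v ∈ tgt, v ≠ X → v.classical = false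

namespace Gate

/-- The control registers. -/
def ctrlRegs (g : Gate) : Finset Reg := g.ctrl.image Prod.fst

/-- All registers on which the gate is defined. -/
def regs (g : Gate) : Finset Reg := g.ctrlRegs ∪ g.tgt

/-- The registers accessed by the gate when `x` is the set of the names of the active gates: the
control registers, and the targets only if the controlled part is active. -/
def access (g : Gate) (x : Finset ℕ) : Finset Reg :=
  if g.id ∈ x then g.ctrlRegs ∪ g.tgt else g.ctrlRegs

/-- The gate does not change the value of `v` in the computational basis (it can read `v`). -/
def Preserves (g : Gate) (v : Reg) : Prop :=
  ∀ h : v ∈ g.tgt, ∀ y z : LocalConfig g.tgt, g.U y z ≠ 0 → y ⟨v, h⟩ = z ⟨v, h⟩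

/-- The control bits activate the gate. -/
def On (g : Gate) (b : Config) : Prop := ∀ c ∈ g.ctrl, (b c.1 : ℕ) = c.2

/-- Execution of a gate in the branch where its control bits are found to activate it, if
`active`, or not to activate it, otherwise: projection on this event, and the action of the gate. -/
noncomputable def step (g : Gate) (active : Prop) (ψ : QState) : QState :=
  open Classical in fun b =>
    if active then
      if g.On b then ∑ y : LocalConfig g.tgt, g.U (fun v => b v.1) y * ψ (b.patch y) else 0
    else if g.On b then 0 else ψ b

end Gate

/-! ### Circuits -/

/-- A finite set of gates with an ordering relation that depends on the values of the control
registers of its gates, recorded as the set `x` of (the names of) the gates whose controlled part is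
active. Only the activity of the component's own gates matters. The relation can involve gates of
other components: it is used in a union of components, on the gates that are present there. -/
structure Component where
  gates : Finset Gate
  rel : Finset ℕ → ℕ → ℕ → Prop
  rel_own : ∀ x, rel x = rel (x ∩ gates.image Gate.id)

namespace Component

/-- The names of the gates. -/
def ids (A : Component) : Finset ℕ := A.gates.image Gate.id

/-- The union of a finite family of components. -/
noncomputable def sum {ι : Type} (s : Finset ι) (F : ι → Component) : Component where
  gates := open Classical in s.biUnion fun i => (F i).gates
  rel x a b := ∃ i ∈ s, (F i).rel x a b
  rel_own x := by
    classical
    funext a b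
    refine propext (exists_congr fun i => and_congr_right fun hi => ?_)
    rw [(F i).rel_own x, (F i).rel_own (x ∩ (s.biUnion fun i => (F i).gates).image Gate.id)]
    have hsub : (F i).gates.image Gate.id ⊆
        (s.biUnion fun i => (F i).gates).image Gate.id :=
      Finset.image_subset_image fun g hg => Finset.mem_biUnion.2 ⟨i, hi, hg⟩
    rw [Finset.inter_assoc, Finset.inter_eq_right.2 hsub]

/-- The union `A + B` of two components. -/
noncomputable instance : Add Component where
  add A B :=
    { gates := open Classical in A.gates ∪ B.gates
      rel := fun x a b => A.rel x a b ∨ B.rel x a b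
      rel_own := by
        classical
        intro x
        funext a b
        have hA : A.gates.image Gate.id ⊆ (A.gates ∪ B.gates).image Gate.id :=
          Finset.image_subset_image Finset.subset_union_left
        have hB : B.gates.image Gate.id ⊆ (A.gates ∪ B.gates).image Gate.id :=
          Finset.image_subset_image Finset.subset_union_right
        rw [A.rel_own x, B.rel_own x, A.rel_own (x ∩ (A.gates ∪ B.gates).image Gate.id),
          B.rel_own (x ∩ (A.gates ∪ B.gates).image Gate.id),
          Finset.inter_assoc, Finset.inter_assoc, Finset.inter_eq_right.2 hA,
          Finset.inter_eq_right.2 hB] }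

/-- The empty component. -/
instance : Zero Component where
  zero := ⟨∅, fun _ _ _ => False, fun _ => rfl⟩

/-- The ordering of the gates that are present: the transitive closure of the relation on them. -/
def before (A : Component) (x : Finset ℕ) : ℕ → ℕ → Prop :=
  Relation.TransGen fun a b => A.rel x a b ∧ a ∈ A.ids ∧ b ∈ A.ids

/-- For all values of the control registers, the gates are partially ordered, and two gates that
access a same register are an ordered pair. The order is causal: which gates come before a given
gate can only depend on the control values of the gates that come before it. -/
structure IsOrdered (A : Component) : Prop where
  id_inj : Set.InjOn Gate.id (A.gates : Set Gate)
  irrefl : ∀ x a, ¬ A.before x a a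
  comparable : ∀ x, ∀ g ∈ A.gates, ∀ h ∈ A.gates, g ≠ h →
    (∃ v, v ∈ g.access x ∧ v ∈ h.access x) → A.rel x g.id h.id ∨ A.rel x h.id g.id
  causal : ∀ x y c, (∀ a, A.before x a c → (a ∈ x ↔ a ∈ y)) →
    ∀ a, A.before y a c ↔ A.before x a c

/-- `L` lists all the gates in an order that is compatible with the partial order for `x`. -/
def IsSchedule (A : Component) (x : Finset ℕ) (L : List Gate) : Prop :=
  L.Nodup ∧ (∀ g, g ∈ L ↔ g ∈ A.gates) ∧ L.Pairwise fun g h => ¬ A.before x h.id g.id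

/-- Execution of a list of gates from the initial state, in the branch where the active gates are
those with a name in `x`. The squared norm of the result is the probability of this branch. -/
noncomputable def run (x : Finset ℕ) (L : List Gate) : QState :=
  L.foldl (fun ψ g => g.step (g.id ∈ x) ψ) initialState

/-- The control values recorded by `x` occur with nonzero probability. -/
def Possible (A : Component) (x : Finset ℕ) : Prop :=
  ∃ L, A.IsSchedule x L ∧ run x L ≠ 0

/-- A circuit that can be executed. In addition to the order constraints, a gate comes after the
gates that set its activation register, and the outcome register of a measurement is not accessed
before the measurement. -/
structure IsCircuit (A : Component) : Prop extends A.IsOrdered where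
  wake : ∀ x, A.Possible x → ∀ g ∈ A.gates, ∀ h ∈ A.gates, g ≠ h → ∀ a, g.wake = some a →
    h.id ∈ x → a ∈ h.tgt → ¬ h.Preserves a → A.before x h.id g.id
  fresh : ∀ x, A.Possible x → ∀ g ∈ A.gates, ∀ h ∈ A.gates, g ≠ h → ∀ X, g.outcome = some X →
    g.id ∈ x → X ∈ h.access x → A.before x g.id h.id

/-- An execution order for each value of the control registers. In a circuit all the possible
choices give the same result, because gates that are not ordered act on disjoint registers. -/
noncomputable def schedule (A : Component) (x : Finset ℕ) : List Gate :=
  Classical.epsilon (A.IsSchedule x)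

/-- The probability that the register `Z` contains `0` at the end of the execution: the sum over the
values of the control registers of the probability that they occur and that `Z = 0`. -/
noncomputable def probZero (A : Component) (Z : Reg) : ℝ :=
  ∑ x ∈ A.ids.powerset,
    ∑' b : Config, if (b Z : ℕ) = 0 then ‖run x (A.schedule x) b‖ ^ 2 else 0

end Component

/-! ### Protocols -/

/-- A module-role-circuit: a circuit executed by a participant, the registers associated with it,
and its corruption register if it is corruptible. -/
structure Role extends Component where
  regs : Finset Reg
  corr : Option Reg

/-- A protocol: a finite set of role-circuits, together with the set `names` of the names that are
reserved for its gates and for its internal registers, its internal channel registers `chan`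
(activation registers shared by several roles included), and the channel types: the environment can
read the classical values of the channels in `readable`, it can use those in `writable` freely, and
it has no access to the other ones. A register of a role whose name is not in `names` and which is
not its corruption register is an input/output channel register, shared with the environment. -/
structure Protocol where
  roles : Finset Role
  names : Set ℕ
  chan : Set Reg
  readable : Set Reg
  writable : Set Reg

namespace Protocol

/-- The union of a finite family of protocols. -/
noncomputable def sum {ι : Type} (s : Finset ι) (F : ι → Protocol) : Protocol where
  roles := open Classical in s.biUnion fun i => (F i).roles
  names := ⋃ i ∈ s, (F i).names
  chan := ⋃ i ∈ s, (F i).chan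
  readable := ⋃ i ∈ s, (F i).readable
  writable := ⋃ i ∈ s, (F i).writable

/-- The union `P + Q` of two protocols. -/
noncomputable instance : Add Protocol where
  add P Q :=
    { roles := open Classical in P.roles ∪ Q.roles
      names := P.names ∪ Q.names
      chan := P.chan ∪ Q.chan
      readable := P.readable ∪ Q.readable
      writable := P.writable ∪ Q.writable }

/-- The gates of a protocol, with the order inside each role-circuit. -/
noncomputable def toComponent (P : Protocol) : Component where
  gates := open Classical in P.roles.biUnion fun r => r.gates
  rel x a b := ∃ r ∈ P.roles, r.rel x a b
  rel_own := (Component.sum P.roles fun r => r.toComponent).rel_own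

/-- The input/output channel registers of a role. -/
def io (P : Protocol) (r : Role) : Set Reg :=
  {v | v ∈ r.regs ∧ v.id ∉ P.names ∧ r.corr ≠ some v}

/-- The rules that every protocol obeys. -/
structure WellFormed (P : Protocol) : Prop where
  /-- Each role is a circuit on its registers; its gates have reserved names, and its order only
  concerns its own gates. -/
  role_circuit : ∀ r ∈ P.roles, r.IsOrdered ∧
    (∀ g ∈ r.gates, g.id ∈ P.names ∧ g.regs ⊆ r.regs) ∧
    ∀ x a b, r.rel x a b → a ∈ r.ids ∧ b ∈ r.ids
  /-- Distinct roles have distinct gates. -/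
  role_disjoint : ∀ r ∈ P.roles, ∀ r' ∈ P.roles, r ≠ r' → Disjoint r.ids r'.ids
  /-- The corruption register of a role is a classical bit, controlled by the environment; every gate
  of the role does nothing when it is on. -/
  corruptible : ∀ r ∈ P.roles, ∀ c, r.corr = some c →
    c.IsBit ∧ c ∈ r.regs ∧ c.id ∉ P.names ∧ ∀ g ∈ r.gates, (c, 0) ∈ g.ctrl
  /-- A corruption register is only used to corrupt; no gate of the protocol acts on it. -/
  corr_only : ∀ r ∈ P.roles, ∀ c, r.corr = some c → ∀ r' ∈ P.roles, c ∈ r'.regs →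
    r'.corr = some c ∧ ∀ g ∈ r'.gates, c ∉ g.tgt
  /-- Internal channels have reserved names, and only channels have a type. -/
  chan_names : ∀ v ∈ P.chan, v.id ∈ P.names
  types : P.readable ⊆ P.chan ∧ P.writable ⊆ P.chan ∧ ∀ v ∈ P.readable, v.classical = true
  /-- Internal registers shared by distinct roles are channel registers. -/
  shared : ∀ r ∈ P.roles, ∀ r' ∈ P.roles, r ≠ r' → ∀ v, v ∈ r.regs → v ∈ r'.regs →
    v.id ∈ P.names → v ∈ P.chan
  /-- A gate that accesses a channel register is a communication gate: it has an activation
  register. -/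
  communication : ∀ r ∈ P.roles, ∀ g ∈ r.gates, ∀ v ∈ g.regs, v ∈ P.chan ∪ P.io r →
    g.wake.isSome

/-- The access of a gate `g` from outside the protocol to the register `v` of the protocol is
permitted: `v` is a channel register and the channel type permits it, or `g` belongs to the adversary
circuit of a corruptible role `r`: it is only active when `r` is corrupted, and it can then access
all registers of `r`, and communicate in its name. -/
def Permits (P : Protocol) (g : Gate) (v : Reg) : Prop :=
  v ∈ P.writable ∨ (v ∈ P.readable ∧ g.Preserves v) ∨
    ∃ r ∈ P.roles, ∃ c, r.corr = some c ∧ (c, 1) ∈ g.ctrl ∧ v ∈ r.regs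

end Protocol

/-! ### Environments, ideal protocols, simulators -/

/-- An environment: a component with an output register. -/
structure Env extends Component where
  Z : Reg

/-- `E` is a valid environment for `P`: it has its own gates, its own registers (whose names are not
reserved for `P`), among them the output bit `Z`, and the other registers of `P` are only accessed as
`P` permits; the input/output channels and the corruption registers are at its disposal. The relation
of `E` includes the choice of an order for the communication gates of `P`, and `E + P` is a
circuit. -/
structure ValidEnv (P : Protocol) (E : Env) : Prop where
  output : E.Z.IsBit ∧ E.Z.id ∉ P.names ∧ ∀ r ∈ P.roles, E.Z ∉ r.regs
  own_gates : ∀ g ∈ E.gates, g.id ∉ P.names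
  permitted : ∀ g ∈ E.gates, ∀ v ∈ g.regs, v.id ∈ P.names → P.Permits g v
  order : ∀ x a b, E.rel x a b →
    (a ∈ P.names → a ∈ P.toComponent.ids) ∧ (b ∈ P.names → b ∈ P.toComponent.ids)
  circuit : (E.toComponent + P.toComponent).IsCircuit

/-- `I` can be associated with `P` as an ideal protocol. Its internal names are reserved for `P` but
not used by its registers or channels (there remain infinitely many names for a simulator); only an
ideal gate that corresponds to a gate of `P` can share the name of the latter. A role `I(r)` has the
corruption register of a role `r` of `P`, and it can use the input/output channels of `r`; every
role of `P` with input/output has such a counterpart. -/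
structure IsIdealFor (P I : Protocol) : Prop where
  names_subset : I.names ⊆ P.names
  names_infinite : (P.names \ I.names).Infinite
  gate_names : ∀ a ∈ P.toComponent.ids, a ∈ I.names → a ∈ I.toComponent.ids
  reg_names : ∀ r ∈ P.roles, ∀ v ∈ r.regs, v.id ∉ I.names
  chan_names : ∀ v ∈ P.chan, v.id ∉ I.names
  corr : ∀ r' ∈ I.roles, ∀ c, r'.corr = some c → ∃ r ∈ P.roles, r.corr = some c
  io_of_ideal : ∀ r' ∈ I.roles, ∀ v ∈ I.io r', ∃ r ∈ P.roles, r.corr = r'.corr ∧ v ∈ P.io r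
  io_of_real : ∀ r ∈ P.roles, ∀ v ∈ P.io r, ∃ r' ∈ I.roles, r'.corr = r.corr ∧ v ∈ I.io r'

/-- `S` is a valid simulator for the protocol `P`, the ideal protocol `I` and the environment `E`.
It has its own gates and registers, with names reserved for `P` and not for `I`. The registers and
channels of `P`, as `E` knows them, are among these: the simulator provides them in the place of `P`,
and its gates can take the names of the gates of `P`, and so their position relative to `E`. It
accesses the ideal protocol as an adversary, in particular the input/output channels only in the name
of corrupted circuits; it can read, but not change, the corruption registers. -/
structure ValidSim (P I : Protocol) (E : Env) (S : Component) : Prop where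
  own_gates : ∀ g ∈ S.gates, g.id ∈ P.names ∧ g.id ∉ I.names
  permitted : ∀ g ∈ S.gates, ∀ v ∈ g.regs,
    (v.id ∈ P.names ∧ v.id ∉ I.names) ∨
    ((∃ r, (r ∈ P.roles ∨ r ∈ I.roles) ∧ r.corr = some v) ∧ g.Preserves v) ∨
    ((∀ r, r ∈ P.roles ∨ r ∈ I.roles → r.corr ≠ some v) ∧ I.Permits g v)
  order : ∀ x a b, S.rel x a b → ∀ d, d = a ∨ d = b →
    (d ∈ S.ids ∨ d ∈ E.ids ∨ d ∈ P.names) ∧ (d ∈ I.names → d ∈ I.toComponent.ids)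
  circuit : (E.toComponent + I.toComponent + S).IsCircuit

/-- The difference `|Pr(Z_{E + P} = 0) - Pr(Z_{E + I + S} = 0)|`. -/
noncomputable def advantage (P I : Protocol) (E : Env) (S : Component) : ℝ :=
  |(E.toComponent + P.toComponent).probZero E.Z -
    (E.toComponent + I.toComponent + S).probZero E.Z|

/-- `P` `ε`-securely realizes `I`, for a fixed value of the security parameter: the error is a
function of the environment. -/
def SecurelyRealizes (P I : Protocol) (ε : Env → ℝ) : Prop :=
  ∀ E, ValidEnv P E → ∃ S, ValidSim P I E S ∧ advantage P I E S ≤ ε E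

/-- The map `σ`, from environments to simulators, witnesses that `P` `ε`-securely realizes `I`. -/
def Simulates (P I : Protocol) (ε : Env → ℝ) (σ : Env → Component) : Prop :=
  ∀ E, ValidEnv P E → ValidSim P I E (σ E) ∧ advantage P I E (σ E) ≤ ε E

/-! ### Trees of sub-protocols -/

/-- A protocol as a tree of modules, each of which has an associated ideal protocol. The nodes are
numbered in the order of a bottom-up traversal: a node comes before its parent, the root is last.
All trees, and all their bottom-up traversals, are obtained in this way. -/
structure ProtocolTree where
  k : ℕ
  parent : Fin (k + 1) → Option (Fin (k + 1))
  parent_root : parent (Fin.last k) = none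
  parent_lt : ∀ Q, Q ≠ Fin.last k → ∃ R, parent Q = some R ∧ Q < R
  /-- the main module of the sub-protocol -/
  M : Fin (k + 1) → Protocol
  /-- the ideal protocol associated with the sub-protocol -/
  I : Fin (k + 1) → Protocol

namespace ProtocolTree

variable (T : ProtocolTree)

/-- The nodes of the tree, that is, the sub-protocols. -/
abbrev Node : Type := Fin (T.k + 1)

/-- The root. -/
abbrev root : T.Node := Fin.last T.k

/-- The sub-protocols that are called by the main module of `Q`. -/
def children (Q : T.Node) : Finset T.Node := Finset.univ.filter fun R => T.parent R = some Q

theorem lt_of_mem_children {Q R : T.Node} (h : R ∈ T.children Q) : R < Q := by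
  have h1 : T.parent R = some Q := (Finset.mem_filter.1 h).2
  have h2 : R ≠ Fin.last T.k := by
    rintro rfl
    rw [T.parent_root] at h1
    cases h1
  obtain ⟨R', h3, h4⟩ := T.parent_lt R h2
  rw [h1] at h3
  cases h3
  exact h4

/-- The sub-protocol `Q = M(Q) + ∑ R ∈ C(Q), R`. -/
noncomputable def sub (Q : T.Node) : Protocol :=
  T.M Q + Protocol.sum (T.children Q).attach fun R => sub R.1
termination_by Q
decreasing_by exact T.lt_of_mem_children R.2

/-- The protocol `Q̃ = M(Q) + ∑ R ∈ C(Q), I(R)`. -/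
noncomputable def tilde (Q : T.Node) : Protocol :=
  T.M Q + Protocol.sum (T.children Q) T.I

/-- The names reserved for the whole tree. -/
def allNames : Set ℕ := ⋃ Q, (T.M Q).names

/-- The rules for the composition of modules. The modules have disjoint sets of reserved names, and
the names of an ideal protocol are reserved for its sub-protocol. A module only communicates, apart
from its internal channels, with its caller and with the modules that it calls: its input/output
channels are channels of the caller, or of the environment for the root. The corruption registers
belong to the environment. -/
structure WellFormed : Prop where
  module : ∀ Q, (T.M Q).WellFormed
  ideal : ∀ Q, (T.I Q).WellFormed
  disjoint : ∀ Q R, Q ≠ R → Disjoint (T.M Q).names (T.M R).names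
  ideal_names : ∀ Q, (T.I Q).names ⊆ (T.M Q).names
  names_left : T.allNamesᶜ.Infinite
  calls : ∀ Q R, T.parent Q = some R → ∀ r ∈ (T.M Q).roles, ∀ v ∈ (T.M Q).io r, v ∈ (T.M R).chan
  root_io : ∀ r ∈ (T.M T.root).roles, ∀ v ∈ (T.M T.root).io r, v.id ∉ T.allNames
  corr_names : ∀ Q, ∀ r ∈ (T.M Q).roles, ∀ c, r.corr = some c → c.id ∉ T.allNames ∧
    ∀ R, ∀ r' ∈ (T.M R).roles, c ∈ r'.regs → r'.corr = some c
  ideal_for : ∀ Q, IsIdealFor (T.tilde Q) (T.I Q)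

/-- The modules that are not yet replaced and the ideal protocols that are not yet replaced, outside
`Q̃`, when the traversal visits `Q`. -/
noncomputable def context (Q : T.Node) : Component :=
  Component.sum (Finset.univ.filter fun R => Q < R) (fun R => (T.M R).toComponent) +
  Component.sum (Finset.univ.filter fun R => R < Q ∧ ∃ R', T.parent R = some R' ∧ Q < R')
    (fun R => (T.I R).toComponent)

/-- The union of the simulators for the first `j` nodes of the traversal, for the environment `E` of
the whole protocol. The simulator of the node `Q` is the one that `σ Q` gives for `E(Q̃)`. -/
noncomputable def simulators (σ : T.Node → Env → Component) (E : Env) : ℕ → Component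
  | 0 => 0
  | j + 1 =>
    if h : j < T.k + 1 then
      simulators σ E j +
        σ ⟨j, h⟩ ⟨E.toComponent + T.context ⟨j, h⟩ + simulators σ E j, E.Z⟩
    else simulators σ E j

/-- The environment `E(Q̃)` of `Q̃` when the traversal visits `Q`: all that is present in the overall
setting at this point, except `Q̃`. -/
noncomputable def envAt (σ : T.Node → Env → Component) (E : Env) (Q : T.Node) : Env :=
  ⟨E.toComponent + T.context Q + T.simulators σ E Q, E.Z⟩

end ProtocolTree

/-! ### Unions of components and of protocols -/

namespace Component

/-! The proof is a hybrid argument. Visit the tree bottom-up and, at each node `Q`, replace `Q̃` by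
`I(Q)` together with the simulator chosen for `E(Q̃)`. When `Q` is reached, its children have
already become ideal protocols, so `Q̃` is literally present and everything else is `E(Q̃)`. Thus
the settings before and after the replacement are consecutive hybrids (`envAt_add_tilde`,
`envAt_add_ideal`). The first hybrid is `E + P` and the last is `E + I(P)` with all the simulators
(`hybrid_zero`, `hybrid_last`); telescoping and the triangle inequality give the sum of the errors
(`advantage_simulators_le`). Executions and probabilities are never unfolded.

The work lies in validity: the hypothesis on `Q̃` applies only if `E(Q̃)` is a valid environment
(`envAt_valid`), and the union of the simulators has to be a valid simulator (`simulators_valid`).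
That the hybrids are circuits is inherited from the validity of `E` and of the previous simulator.
The rest is bookkeeping of names. Each reserved name is owned by one module; the names of `Q̃` are
owned by `Q`, or are owned by a child `R` and reserved for `I(R)`. A simulator for `R̃` owns names
of `R̃` outside `I(R)`, hence none of a later `Q̃` (`notMem_tilde_of_sim`). Module boundaries are
crossed only by corruption registers, whose names lie outside the tree, and by input/output
channels, whose names belong to the caller or, at the root, lie outside the tree. -/

theorem eq_of_gates_rel {A B : Component} (hg : ∀ g, g ∈ A.gates ↔ g ∈ B.gates)
    (hr : ∀ x a b, A.rel x a b ↔ B.rel x a b) : A = B := by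
  obtain ⟨gA, rA, hA⟩ := A
  obtain ⟨gB, rB, hB⟩ := B
  obtain rfl : gA = gB := Finset.ext hg
  obtain rfl : rA = rB := by
    funext x a b
    exact propext (hr x a b)
  rfl

@[simp] theorem mem_gates_add {A B : Component} {g : Gate} :
    g ∈ (A + B).gates ↔ g ∈ A.gates ∨ g ∈ B.gates := by
  classical
  exact Finset.mem_union

@[simp] theorem mem_gates_sum {ι : Type} {s : Finset ι} {F : ι → Component} {g : Gate} :
    g ∈ (sum s F).gates ↔ ∃ i ∈ s, g ∈ (F i).gates := by
  classical
  exact Finset.mem_biUnion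

@[simp] theorem mem_gates_zero {g : Gate} : g ∈ (0 : Component).gates ↔ False :=
  iff_of_false (Finset.notMem_empty g) id

@[simp] theorem rel_add {A B : Component} {x : Finset ℕ} {a b : ℕ} :
    (A + B).rel x a b ↔ A.rel x a b ∨ B.rel x a b := Iff.rfl

@[simp] theorem rel_sum {ι : Type} {s : Finset ι} {F : ι → Component} {x : Finset ℕ} {a b : ℕ} :
    (sum s F).rel x a b ↔ ∃ i ∈ s, (F i).rel x a b := Iff.rfl

theorem mem_ids {A : Component} {a : ℕ} : a ∈ A.ids ↔ ∃ g ∈ A.gates, g.id = a :=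
  Finset.mem_image

theorem mem_ids_of_mem {A : Component} {g : Gate} (hg : g ∈ A.gates) : g.id ∈ A.ids :=
  mem_ids.2 ⟨g, hg, rfl⟩

@[simp] theorem mem_ids_add {A B : Component} {a : ℕ} :
    a ∈ (A + B).ids ↔ a ∈ A.ids ∨ a ∈ B.ids := by
  simp only [mem_ids, mem_gates_add, or_and_right, exists_or]

@[simp] theorem mem_ids_sum {ι : Type} {s : Finset ι} {F : ι → Component} {a : ℕ} :
    a ∈ (sum s F).ids ↔ ∃ i ∈ s, a ∈ (F i).ids := by
  simp only [mem_ids, mem_gates_sum]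
  constructor
  · rintro ⟨g, ⟨i, hi, hg⟩, rfl⟩
    exact ⟨i, hi, g, hg, rfl⟩
  · rintro ⟨i, hi, g, hg, rfl⟩
    exact ⟨g, ⟨i, hi, hg⟩, rfl⟩

/-- A property of components that holds for a union iff it holds for one of its parts. -/
structure Additive (p : Component → Prop) : Prop where
  zero : ¬ p 0
  add : ∀ A B, p (A + B) ↔ p A ∨ p B
  sum : ∀ {ι : Type} (s : Finset ι) (F : ι → Component), p (Component.sum s F) ↔ ∃ i ∈ s, p (F i)

theorem additive_mem_gates (g : Gate) : Additive fun A => g ∈ A.gates :=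
  ⟨by simp, fun _ _ => mem_gates_add, fun _ _ => mem_gates_sum⟩

theorem additive_rel (x : Finset ℕ) (a b : ℕ) : Additive fun A => A.rel x a b :=
  ⟨id, fun _ _ => Iff.rfl, fun _ _ => Iff.rfl⟩

theorem additive_mem_ids (a : ℕ) : Additive fun A => a ∈ A.ids :=
  ⟨Finset.notMem_empty a, fun _ _ => mem_ids_add, fun _ _ => mem_ids_sum⟩

/-- Gates and order relations are both detected by additive properties, so an identity between
unions becomes a propositional equivalence between disjunctions, settled by cases. All identities
between hybrids are proved in this way. -/
theorem eq_of_additive {A B : Component} (h : ∀ p, Additive p → (p A ↔ p B)) : A = B :=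
  eq_of_gates_rel (fun g => h _ (additive_mem_gates g)) fun x a b => h _ (additive_rel x a b)

end Component

namespace Protocol

@[simp] theorem mem_roles_add {P Q : Protocol} {r : Role} :
    r ∈ (P + Q).roles ↔ r ∈ P.roles ∨ r ∈ Q.roles := by
  classical
  exact Finset.mem_union

@[simp] theorem mem_roles_sum {ι : Type} {s : Finset ι} {F : ι → Protocol} {r : Role} :
    r ∈ (sum s F).roles ↔ ∃ i ∈ s, r ∈ (F i).roles := by
  classical
  exact Finset.mem_biUnion

@[simp] theorem mem_gates_toComponent {P : Protocol} {g : Gate} :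
    g ∈ P.toComponent.gates ↔ ∃ r ∈ P.roles, g ∈ r.gates := by
  classical
  exact Finset.mem_biUnion

@[simp] theorem rel_toComponent {P : Protocol} {x : Finset ℕ} {a b : ℕ} :
    P.toComponent.rel x a b ↔ ∃ r ∈ P.roles, r.rel x a b := Iff.rfl

theorem toComponent_add (P Q : Protocol) :
    (P + Q).toComponent = P.toComponent + Q.toComponent := by
  refine Component.eq_of_gates_rel (fun g => ?_) fun x a b => ?_ <;>
    simp [or_and_right, exists_or]

theorem toComponent_sum {ι : Type} (s : Finset ι) (F : ι → Protocol) :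
    (sum s F).toComponent = Component.sum s fun i => (F i).toComponent := by
  refine Component.eq_of_gates_rel (fun g => ?_) fun x a b => ?_
  · simp only [mem_gates_toComponent, mem_roles_sum, Component.mem_gates_sum]
    constructor
    · rintro ⟨r, ⟨i, hi, hr⟩, hg⟩
      exact ⟨i, hi, r, hr, hg⟩
    · rintro ⟨i, hi, r, hr, hg⟩
      exact ⟨r, ⟨i, hi, hr⟩, hg⟩
  · simp only [rel_toComponent, mem_roles_sum, Component.rel_sum]
    constructor
    · rintro ⟨r, ⟨i, hi, hr⟩, hg⟩
      exact ⟨i, hi, r, hr, hg⟩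
    · rintro ⟨i, hi, r, hr, hg⟩
      exact ⟨r, ⟨i, hi, hr⟩, hg⟩

theorem WellFormed.id_mem_names {P : Protocol} (h : P.WellFormed) {a : ℕ}
    (ha : a ∈ P.toComponent.ids) : a ∈ P.names := by
  obtain ⟨g, hg, rfl⟩ := Component.mem_ids.1 ha
  obtain ⟨r, hr, hgr⟩ := mem_gates_toComponent.1 hg
  exact ((h.role_circuit r hr).2.1 g hgr).1

theorem WellFormed.rel_mem_ids {P : Protocol} (h : P.WellFormed) {x : Finset ℕ} {a b d : ℕ}
    (hab : P.toComponent.rel x a b) (hd : d = a ∨ d = b) : d ∈ P.toComponent.ids := by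
  obtain ⟨r, hr, hrel⟩ := rel_toComponent.1 hab
  have hids := (h.role_circuit r hr).2.2 x a b hrel
  have hdr : d ∈ r.ids := by
    rcases hd with rfl | rfl
    exacts [hids.1, hids.2]
  obtain ⟨g, hg, rfl⟩ := Component.mem_ids.1 hdr
  exact Component.mem_ids_of_mem (mem_gates_toComponent.2 ⟨r, hr, hg⟩)

/-- A register of a role is internal, or its corruption register, or an input/output channel. -/
theorem reg_cases {P : Protocol} {r : Role} {v : Reg} (hv : v ∈ r.regs) :
    v.id ∈ P.names ∨ r.corr = some v ∨ v ∈ P.io r := by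
  by_cases h1 : v.id ∈ P.names
  · exact Or.inl h1
  by_cases h2 : r.corr = some v
  · exact Or.inr (Or.inl h2)
  · exact Or.inr (Or.inr ⟨hv, h1, h2⟩)

end Protocol

namespace ProtocolTree

variable {T : ProtocolTree}

/-! ### The sub-protocols of a tree -/

theorem mem_children {Q R : T.Node} : R ∈ T.children Q ↔ T.parent R = some Q := by
  simp [children]

theorem exists_parent {Q R : T.Node} (h : Q < R) :
    ∃ R', T.parent Q = some R' ∧ Q < R' :=
  T.parent_lt Q (h.trans_le (Fin.le_last R)).ne

theorem lt_of_parent {Q R : T.Node} (h : T.parent R = some Q) : R < Q :=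
  T.lt_of_mem_children (mem_children.2 h)

/-- An attribute of protocols that is compatible with unions is, for the whole protocol, the union
of the attributes of the modules. -/
theorem sub_root_iff (p : Protocol → Prop) (hadd : ∀ P Q, p (P + Q) ↔ p P ∨ p Q)
    (hsum : ∀ {ι : Type} (s : Finset ι) (F : ι → Protocol),
      p (Protocol.sum s F) ↔ ∃ i ∈ s, p (F i)) :
    p (T.sub T.root) ↔ ∃ Q, p (T.M Q) := by
  have hsub : ∀ Q, p (T.sub Q) ↔ p (T.M Q) ∨ ∃ R, T.parent R = some Q ∧ p (T.sub R) := by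
    intro Q
    rw [sub, hadd, hsum]
    simp [mem_children]
  constructor
  · have hdown : ∀ Q, p (T.sub Q) → ∃ R, p (T.M R) := by
      intro Q
      induction Q using WellFoundedLT.induction with
      | ind Q ih =>
        intro hQ
        rcases (hsub Q).1 hQ with h | ⟨R, hR, h⟩
        · exact ⟨Q, h⟩
        · exact ih R (lt_of_parent hR) h
    exact hdown _
  -- Attributes travel from a node to its parent, which has a larger index; the induction therefore
  -- runs downwards from the root.
  · have hup : ∀ Q, p (T.sub Q) → p (T.sub T.root) := by
      intro Q
      induction Q using WellFoundedGT.induction with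
      | ind Q ih =>
        intro hQ
        by_cases hr : Q = T.root
        · exact hr ▸ hQ
        · obtain ⟨R, hR, hlt⟩ := T.parent_lt Q hr
          exact ih R hlt ((hsub R).2 (Or.inr ⟨Q, hR, hQ⟩))
    rintro ⟨Q, hQ⟩
    exact hup Q ((hsub Q).2 (Or.inl hQ))

theorem mem_roles_sub_root {r : Role} :
    r ∈ (T.sub T.root).roles ↔ ∃ Q, r ∈ (T.M Q).roles :=
  sub_root_iff (fun P => r ∈ P.roles) (fun _ _ => Protocol.mem_roles_add)
    fun _ _ => Protocol.mem_roles_sum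

theorem names_sub_root : (T.sub T.root).names = T.allNames := by
  ext a
  rw [sub_root_iff (fun P => a ∈ P.names) (fun _ _ => Iff.rfl)
    fun _ _ => by simp [Protocol.sum]]
  simp [allNames]

theorem mem_writable_sub_root {v : Reg} :
    v ∈ (T.sub T.root).writable ↔ ∃ Q, v ∈ (T.M Q).writable :=
  sub_root_iff (fun P => v ∈ P.writable) (fun _ _ => Iff.rfl)
    fun _ _ => by simp [Protocol.sum]

theorem mem_readable_sub_root {v : Reg} :
    v ∈ (T.sub T.root).readable ↔ ∃ Q, v ∈ (T.M Q).readable :=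
  sub_root_iff (fun P => v ∈ P.readable) (fun _ _ => Iff.rfl)
    fun _ _ => by simp [Protocol.sum]

theorem toComponent_sub_root :
    (T.sub T.root).toComponent = Component.sum Finset.univ fun Q => (T.M Q).toComponent := by
  rw [← Protocol.toComponent_sum]
  have hroles : (T.sub T.root).roles = (Protocol.sum Finset.univ T.M).roles := by
    ext r
    simp [mem_roles_sub_root]
  refine Component.eq_of_gates_rel (fun g => ?_) fun x a b => ?_
  · rw [Protocol.mem_gates_toComponent, hroles, Protocol.mem_gates_toComponent]
  · rw [Protocol.rel_toComponent, hroles, Protocol.rel_toComponent]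

theorem mem_roles_tilde {Q : T.Node} {r : Role} :
    r ∈ (T.tilde Q).roles ↔
      r ∈ (T.M Q).roles ∨ ∃ R, T.parent R = some Q ∧ r ∈ (T.I R).roles := by
  simp [tilde, mem_children]

theorem mem_names_tilde {Q : T.Node} {a : ℕ} :
    a ∈ (T.tilde Q).names ↔
      a ∈ (T.M Q).names ∨ ∃ R, T.parent R = some Q ∧ a ∈ (T.I R).names := by
  have h : (T.tilde Q).names = (T.M Q).names ∪ ⋃ R ∈ T.children Q, (T.I R).names := rfl
  simp [h, mem_children]

theorem mem_writable_tilde {Q : T.Node} {v : Reg} :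
    v ∈ (T.tilde Q).writable ↔
      v ∈ (T.M Q).writable ∨ ∃ R, T.parent R = some Q ∧ v ∈ (T.I R).writable := by
  have h : (T.tilde Q).writable = (T.M Q).writable ∪ ⋃ R ∈ T.children Q, (T.I R).writable := rfl
  simp [h, mem_children]

theorem mem_readable_tilde {Q : T.Node} {v : Reg} :
    v ∈ (T.tilde Q).readable ↔
      v ∈ (T.M Q).readable ∨ ∃ R, T.parent R = some Q ∧ v ∈ (T.I R).readable := by
  have h : (T.tilde Q).readable = (T.M Q).readable ∪ ⋃ R ∈ T.children Q, (T.I R).readable := rfl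
  simp [h, mem_children]

theorem mem_chan_tilde_of_mem {Q : T.Node} {v : Reg} (hv : v ∈ (T.M Q).chan) :
    v ∈ (T.tilde Q).chan := Or.inl hv

theorem toComponent_tilde (Q : T.Node) :
    (T.tilde Q).toComponent = (T.M Q).toComponent +
      Component.sum (T.children Q) fun R => (T.I R).toComponent := by
  rw [tilde, Protocol.toComponent_add, Protocol.toComponent_sum]

theorem mem_ids_tilde {Q : T.Node} {a : ℕ} :
    a ∈ (T.tilde Q).toComponent.ids ↔ a ∈ (T.M Q).toComponent.ids ∨
      ∃ R, T.parent R = some Q ∧ a ∈ (T.I R).toComponent.ids := by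
  simp [toComponent_tilde, mem_children]

/-! ### Hybrid settings -/

variable (σ : T.Node → Env → Component) (E : Env)

/-- Unrolls the nested recursion: the environment built inside `simulators` at stage `R` is
definitionally `envAt` at `R`. -/
theorem simulators_iff {p : Component → Prop} (hp : Component.Additive p) (j : ℕ) :
    p (T.simulators σ E j) ↔ ∃ R : T.Node, R < j ∧ p (σ R (T.envAt σ E R)) := by
  induction j with
  | zero => simp [simulators, hp.zero]
  | succ j ih =>
    by_cases h : j < T.k + 1
    · have hs : T.simulators σ E (j + 1) =
          T.simulators σ E j + σ ⟨j, h⟩ (T.envAt σ E ⟨j, h⟩) := by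
        rw [simulators, dif_pos h]
        rfl
      rw [hs, hp.add, ih]
      constructor
      · rintro (⟨R, hR, hg⟩ | hg)
        · exact ⟨R, hR.trans (Nat.lt_succ_self j), hg⟩
        · exact ⟨_, Nat.lt_succ_self j, hg⟩
      · rintro ⟨R, hR, hg⟩
        rcases Nat.lt_succ_iff_lt_or_eq.1 hR with hlt | heq
        · exact Or.inl ⟨R, hlt, hg⟩
        · obtain rfl : R = ⟨j, h⟩ := Fin.ext heq
          exact Or.inr hg
    -- Past the last node nothing is added, and no node has index `j`.
    · rw [simulators, dif_neg h, ih]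
      refine exists_congr fun R => and_congr_left fun _ => ?_
      have := R.isLt
      omega

/-- All that is present, besides `E`, when the first `j` nodes of the traversal have been
replaced. -/
noncomputable def hybrid (j : ℕ) : Component :=
  E.toComponent +
  Component.sum (Finset.univ.filter fun R : T.Node => j ≤ R) (fun R => (T.M R).toComponent) +
  Component.sum (Finset.univ.filter fun R : T.Node =>
    R < j ∧ ∀ R' : T.Node, T.parent R = some R' → j ≤ R') (fun R => (T.I R).toComponent) +
  T.simulators σ E j

theorem hybrid_iff {p : Component → Prop} (hp : Component.Additive p) (j : ℕ) :
    p (T.hybrid σ E j) ↔ p E.toComponent ∨ (∃ R : T.Node, j ≤ R ∧ p (T.M R).toComponent) ∨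
      (∃ R : T.Node, R < j ∧ (∀ R' : T.Node, T.parent R = some R' → j ≤ R') ∧
        p (T.I R).toComponent) ∨
      ∃ R : T.Node, R < j ∧ p (σ R (T.envAt σ E R)) := by
  simp [hybrid, hp.add, hp.sum, simulators_iff σ E hp, or_assoc, and_assoc]

theorem envAt_iff {p : Component → Prop} (hp : Component.Additive p) (Q : T.Node) :
    p (T.envAt σ E Q).toComponent ↔
      p E.toComponent ∨ (∃ R : T.Node, Q < R ∧ p (T.M R).toComponent) ∨
      (∃ R : T.Node, R < Q ∧ (∃ R', T.parent R = some R' ∧ Q < R') ∧ p (T.I R).toComponent) ∨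
      ∃ R : T.Node, R < Q ∧ p (σ R (T.envAt σ E R)) := by
  have h : (T.envAt σ E Q).toComponent = E.toComponent + T.context Q + T.simulators σ E Q := rfl
  simp [h, context, hp.add, hp.sum, simulators_iff σ E hp, or_assoc, and_assoc]

theorem hybrid_zero : T.hybrid σ E 0 = E.toComponent + (T.sub T.root).toComponent := by
  refine Component.eq_of_additive fun p hp => ?_
  simp [hybrid_iff σ E hp, hp.add, hp.sum, toComponent_sub_root]

theorem hybrid_last : T.hybrid σ E (T.k + 1) =
    E.toComponent + (T.I T.root).toComponent + T.simulators σ E (T.k + 1) := by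
  refine Component.eq_of_additive fun p hp => ?_
  rw [hybrid_iff σ E hp, hp.add, hp.add, simulators_iff σ E hp, or_assoc]
  have h1 : ¬ ∃ R : T.Node, T.k + 1 ≤ R ∧ p (T.M R).toComponent := by
    rintro ⟨R, hR, -⟩
    have := R.isLt
    omega
  have h2 : (∃ R : T.Node, R < T.k + 1 ∧
      (∀ R' : T.Node, T.parent R = some R' → T.k + 1 ≤ R') ∧ p (T.I R).toComponent) ↔
      p (T.I T.root).toComponent := by
    constructor
    · rintro ⟨R, -, hR, hpR⟩
      by_cases hr : R = T.root
      · exact hr ▸ hpR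
      · obtain ⟨R', hR', -⟩ := T.parent_lt R hr
        have := hR R' hR'
        have := R'.isLt
        omega
    · intro h
      -- The root has no parent, so the condition on the caller is vacuous: its ideal protocol alone
      -- is never absorbed by a later replacement.
      refine ⟨T.root, T.root.isLt, fun R' hR' => ?_, h⟩
      rw [T.parent_root] at hR'
      cases hR'
  rw [h2]
  simp only [h1, false_or]

/-- The ideal protocols present in the hybrid have a caller that is `Q` or later. Those called by
`Q` belong to `Q̃`, the others to the context. -/
theorem envAt_add_tilde (Q : T.Node) :
    (T.envAt σ E Q).toComponent + (T.tilde Q).toComponent = T.hybrid σ E Q := by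
  refine Component.eq_of_additive fun p hp => ?_
  rw [hybrid_iff σ E hp, hp.add, envAt_iff σ E hp, toComponent_tilde, hp.add, hp.sum]
  constructor
  · rintro ((h | ⟨R, hR, h⟩ | ⟨R, hR, ⟨R', hR', hlt⟩, h⟩ | h) | h | ⟨R, hR, h⟩)
    · exact Or.inl h
    · exact Or.inr (Or.inl ⟨R, hR.le, h⟩)
    · refine Or.inr (Or.inr (Or.inl ⟨R, hR, fun S hS => ?_, h⟩))
      rw [hR'] at hS
      cases hS
      exact hlt.le
    · exact Or.inr (Or.inr (Or.inr h))
    · exact Or.inr (Or.inl ⟨Q, le_rfl, h⟩)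
    · have hR' := mem_children.1 hR
      refine Or.inr (Or.inr (Or.inl ⟨R, lt_of_parent hR', fun S hS => ?_, h⟩))
      rw [hR'] at hS
      cases hS
      exact le_rfl
  · rintro (h | ⟨R, hR, h⟩ | ⟨R, hR, hpar, h⟩ | h)
    · exact Or.inl (Or.inl h)
    · rcases (show Q ≤ R from hR).eq_or_lt with rfl | hlt
      · exact Or.inr (Or.inl h)
      · exact Or.inl (Or.inr (Or.inl ⟨R, hlt, h⟩))
    · obtain ⟨R', hR', -⟩ := exists_parent (show R < Q from hR)
      rcases (show Q ≤ R' from hpar R' hR').eq_or_lt with rfl | hlt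
      · exact Or.inr (Or.inr ⟨R, mem_children.2 hR', h⟩)
      · exact Or.inl (Or.inr (Or.inr (Or.inl ⟨R, hR, ⟨R', hR', hlt⟩, h⟩)))
    · exact Or.inl (Or.inr (Or.inr (Or.inr h)))

/-- Passing from index `Q` to `Q + 1` removes `M(Q)` and the ideal protocols called by `Q`, and adds
`I(Q)` and its simulator; the context of `Q` is what the two hybrids share besides `E` and the
earlier simulators. -/
theorem envAt_add_ideal (Q : T.Node) :
    (T.envAt σ E Q).toComponent + (T.I Q).toComponent + σ Q (T.envAt σ E Q) =
      T.hybrid σ E (Q + 1) := by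
  refine Component.eq_of_additive fun p hp => ?_
  rw [hybrid_iff σ E hp, hp.add, hp.add, envAt_iff σ E hp]
  constructor
  · rintro (((h | ⟨R, hR, h⟩ | ⟨R, hR, ⟨R', hR', hlt⟩, h⟩ | ⟨R, hR, h⟩) | h) | h)
    · exact Or.inl h
    · exact Or.inr (Or.inl ⟨R, hR, h⟩)
    · refine Or.inr (Or.inr (Or.inl ⟨R, Nat.lt_succ_of_lt hR, fun S hS => ?_, h⟩))
      rw [hR'] at hS
      cases hS
      exact hlt
    · exact Or.inr (Or.inr (Or.inr ⟨R, Nat.lt_succ_of_lt hR, h⟩))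
    · exact Or.inr (Or.inr (Or.inl ⟨Q, Nat.lt_succ_self _, fun S hS => lt_of_parent hS, h⟩))
    · exact Or.inr (Or.inr (Or.inr ⟨Q, Nat.lt_succ_self _, h⟩))
  · rintro (h | ⟨R, hR, h⟩ | ⟨R, hR, hpar, h⟩ | ⟨R, hR, h⟩)
    · exact Or.inl (Or.inl (Or.inl h))
    · exact Or.inl (Or.inl (Or.inr (Or.inl ⟨R, hR, h⟩)))
    · rcases (show R ≤ Q from Nat.le_of_lt_succ hR).eq_or_lt with rfl | hlt
      · exact Or.inl (Or.inr h)
      · obtain ⟨R', hR', -⟩ := exists_parent hlt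
        exact Or.inl (Or.inl (Or.inr (Or.inr (Or.inl ⟨R, hlt, ⟨R', hR', hpar R' hR'⟩, h⟩))))
    · rcases (show R ≤ Q from Nat.le_of_lt_succ hR).eq_or_lt with rfl | hlt
      · exact Or.inr h
      · exact Or.inl (Or.inl (Or.inr (Or.inr (Or.inr ⟨R, hlt, h⟩))))

/-! ### Names and registers in a well-formed tree -/

section WellFormed

variable (hT : T.WellFormed)
include hT

theorem eq_of_mem_names {Q R : T.Node} {a : ℕ} (hQ : a ∈ (T.M Q).names)
    (hR : a ∈ (T.M R).names) : Q = R := by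
  by_contra hne
  exact Set.disjoint_left.1 (hT.disjoint Q R hne) hQ hR

omit hT in
theorem mem_allNames {Q : T.Node} {a : ℕ} (ha : a ∈ (T.M Q).names) : a ∈ T.allNames :=
  Set.mem_iUnion.2 ⟨Q, ha⟩

/-- The owner of a name of `Q̃` is `Q` or one of its children. -/
theorem owner_of_mem_names_tilde {Q : T.Node} {a : ℕ} (ha : a ∈ (T.tilde Q).names) :
    a ∈ (T.M Q).names ∨
      ∃ R, T.parent R = some Q ∧ a ∈ (T.M R).names ∧ a ∈ (T.I R).names := by
  rcases mem_names_tilde.1 ha with h | ⟨R, hR, h⟩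
  · exact Or.inl h
  · exact Or.inr ⟨R, hR, hT.ideal_names R h, h⟩

theorem mem_allNames_of_mem_tilde {Q : T.Node} {a : ℕ} (ha : a ∈ (T.tilde Q).names) :
    a ∈ T.allNames := by
  rcases owner_of_mem_names_tilde hT ha with h | ⟨R, -, h, -⟩
  exacts [mem_allNames h, mem_allNames h]

theorem ideal_subset_tilde (Q : T.Node) : (T.I Q).names ⊆ (T.tilde Q).names :=
  fun _ ha => Or.inl (hT.ideal_names Q ha)

/-- The names of later modules are not used by `Q̃`. -/
theorem notMem_tilde_of_lt {Q R : T.Node} {a : ℕ} (hlt : Q < R) (ha : a ∈ (T.M R).names) :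
    a ∉ (T.tilde Q).names := by
  intro h
  rcases owner_of_mem_names_tilde hT h with h | ⟨S, hS, h, -⟩
  · exact hlt.ne (eq_of_mem_names hT h ha)
  · exact ((lt_of_parent hS).trans hlt).ne (eq_of_mem_names hT h ha)

/-- The names of a simulator for `R̃` are not used by a later `Q̃`. -/
theorem notMem_tilde_of_sim {Q R : T.Node} {a : ℕ} (hlt : R < Q) (ha : a ∈ (T.tilde R).names)
    (ha' : a ∉ (T.I R).names) : a ∉ (T.tilde Q).names := by
  intro h
  -- Compare the owners of the name in `R̃` and in `Q̃`. Owners `R` and `Q`, or a child of `R` and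
  -- `Q`, contradict the order; if `R` is itself a child of `Q`, the name would be reserved for
  -- `I(R)`; a child of both would have two parents.
  rcases owner_of_mem_names_tilde hT ha with ha | ⟨R', hR', ha, -⟩ <;>
    rcases owner_of_mem_names_tilde hT h with h | ⟨S, hS, h, hI⟩
  · exact hlt.ne (eq_of_mem_names hT ha h)
  · obtain rfl := eq_of_mem_names hT ha h
    exact ha' hI
  · exact ((lt_of_parent hR').trans hlt).ne (eq_of_mem_names hT ha h)
  · obtain rfl := eq_of_mem_names hT ha h
    rw [hS] at hR'
    cases hR'
    exact hlt.false

/-- The names of an ideal protocol are not used by a `Q̃` that does not contain it. -/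
theorem notMem_tilde_of_ideal {Q R R' : T.Node} {a : ℕ} (hR : T.parent R = some R')
    (hne : R' ≠ Q) (hlt : R < Q) (ha : a ∈ (T.I R).names) : a ∉ (T.tilde Q).names := by
  intro h
  rcases owner_of_mem_names_tilde hT h with h | ⟨S, hS, h, -⟩
  · exact hlt.ne (eq_of_mem_names hT (hT.ideal_names R ha) h)
  · obtain rfl := eq_of_mem_names hT (hT.ideal_names R ha) h
    rw [hS] at hR
    cases hR
    exact hne rfl

theorem parent_eq_of_mem_names {Q R : T.Node} {a : ℕ} (hlt : R < Q) (ha : a ∈ (T.I R).names)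
    (h : a ∈ (T.tilde Q).names) : T.parent R = some Q := by
  obtain ⟨R', hR', -⟩ := exists_parent hlt
  by_cases hne : R' = Q
  · exact hne ▸ hR'
  · exact absurd h (notMem_tilde_of_ideal hT hR' hne hlt ha)

/-! ### Corruption registers and input/output channels of modules and ideal protocols. -/

theorem corr_mem_regs {Q : T.Node} {r : Role} {c : Reg} (hr : r ∈ (T.M Q).roles)
    (hc : r.corr = some c) : c ∈ r.regs :=
  ((hT.module Q).corruptible r hr c hc).2.1

/-- The corruption registers of ideal protocols are those of modules. -/
theorem exists_module_corr {R : T.Node} {r : Role} {c : Reg} (hr : r ∈ (T.I R).roles)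
    (hc : r.corr = some c) : ∃ Q, ∃ r' ∈ (T.M Q).roles, r'.corr = some c := by
  induction R using WellFoundedLT.induction generalizing r with
  | ind R ih =>
    obtain ⟨r', hr', hc'⟩ := (hT.ideal_for R).corr r hr c hc
    rcases mem_roles_tilde.1 hr' with h | ⟨S, hS, h⟩
    · exact ⟨R, r', h, hc'⟩
    · exact ih S (lt_of_parent hS) h hc'

theorem ideal_corr_notMem {R : T.Node} {r : Role} {c : Reg} (hr : r ∈ (T.I R).roles)
    (hc : r.corr = some c) : c.id ∉ T.allNames := by
  obtain ⟨Q, r', hr', hc'⟩ := exists_module_corr hT hr hc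
  exact (hT.corr_names Q r' hr' c hc').1

theorem exists_module_corr_of_tilde {R : T.Node} {r : Role} {c : Reg}
    (hr : r ∈ (T.tilde R).roles ∨ r ∈ (T.I R).roles) (hc : r.corr = some c) :
    ∃ Q, ∃ r' ∈ (T.M Q).roles, r'.corr = some c := by
  rcases hr with hr | hr
  · rcases mem_roles_tilde.1 hr with h | ⟨S, -, h⟩
    · exact ⟨R, r, h, hc⟩
    · exact exists_module_corr hT h hc
  · exact exists_module_corr hT hr hc

/-- The input/output of an ideal protocol is that of the main module. -/
theorem module_io_of_ideal {R : T.Node} {r : Role} {v : Reg} (hr : r ∈ (T.I R).roles)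
    (hv : v ∈ (T.I R).io r) : ∃ r' ∈ (T.M R).roles, r'.corr = r.corr ∧ v ∈ (T.M R).io r' := by
  induction R using WellFoundedLT.induction generalizing r with
  | ind R ih =>
    obtain ⟨r', hr', hc, hv', hn, hne⟩ := (hT.ideal_for R).io_of_ideal r hr v hv
    have hnM : v.id ∉ (T.M R).names := fun h => hn (Or.inl h)
    rcases mem_roles_tilde.1 hr' with h | ⟨S, hS, h⟩
    · exact ⟨r', h, hc, hv', hnM, hne⟩
    · have hnS : v.id ∉ (T.I S).names := fun h => hn (mem_names_tilde.2 (Or.inr ⟨S, hS, h⟩))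
      obtain ⟨r₀, hr₀, -, hio⟩ := ih S (lt_of_parent hS) h ⟨hv', hnS, hne⟩
      -- Input/output of a child is a channel of `M(R)`, so its name is reserved there and it cannot
      -- be input/output of `R̃`.
      exact absurd ((hT.module R).chan_names v (hT.calls S R hS r₀ hr₀ v hio)) hnM

/-- The input/output channels of a module are channels of its caller. -/
theorem io_chan {R R' : T.Node} (hR : T.parent R = some R') {r : Role} {v : Reg}
    (hr : r ∈ (T.M R).roles) (hv : v ∈ (T.M R).io r) :
    v ∈ (T.M R').chan ∧ v.id ∈ (T.M R').names := by
  have h := hT.calls R R' hR r hr v hv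
  exact ⟨h, (hT.module R').chan_names v h⟩

/-- The association with `I(R)` speaks of the input/output of `R̃`, so the register must also avoid
the names of the called ideal protocols. It does, since its name belongs to the caller, a later
node, or lies outside the tree. -/
theorem ideal_io_of_module {R : T.Node} {r : Role} {v : Reg} (hr : r ∈ (T.M R).roles)
    (hv : v ∈ (T.M R).io r) : ∃ r' ∈ (T.I R).roles, r'.corr = r.corr ∧ v ∈ (T.I R).io r' := by
  refine (hT.ideal_for R).io_of_real r (mem_roles_tilde.2 (Or.inl hr)) v ⟨hv.1, ?_, hv.2.2⟩
  by_cases hR : R = T.root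
  · subst hR
    exact fun h => hT.root_io r hr v hv (mem_allNames_of_mem_tilde hT h)
  · obtain ⟨R', hR', hlt⟩ := T.parent_lt R hR
    exact notMem_tilde_of_lt hT hlt (io_chan hT hR' hr hv).2

/-- The registers of ideal protocols that are not internal belong to modules. -/
theorem module_reg_of_ideal {R : T.Node} {r : Role} {v : Reg} (hr : r ∈ (T.I R).roles)
    (hv : v ∈ r.regs) (hn : v.id ∉ (T.I R).names) : ∃ Q, ∃ r' ∈ (T.M Q).roles, v ∈ r'.regs := by
  rcases Protocol.reg_cases (P := T.I R) hv with h | h | h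
  · exact absurd h hn
  · obtain ⟨Q, r', hr', hc⟩ := exists_module_corr hT hr h
    exact ⟨Q, r', hr', corr_mem_regs hT hr' hc⟩
  · obtain ⟨r', hr', -, hio⟩ := module_io_of_ideal hT hr h
    exact ⟨R, r', hr', hio.1⟩

/-- A gate name of the module `R` that is reserved for `Q̃` is the name of a gate of `Q̃`. -/
theorem mem_ids_tilde_of_module {Q R : T.Node} {a : ℕ} (ha : a ∈ (T.M R).toComponent.ids)
    (h : a ∈ (T.tilde Q).names) : a ∈ (T.tilde Q).toComponent.ids := by
  have hR := (hT.module R).id_mem_names ha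
  rcases owner_of_mem_names_tilde hT h with h | ⟨S, hS, h, hI⟩
  · obtain rfl := eq_of_mem_names hT hR h
    exact mem_ids_tilde.2 (Or.inl ha)
  · obtain rfl := eq_of_mem_names hT hR h
    exact mem_ids_tilde.2 (Or.inr ⟨R, hS,
      (hT.ideal_for R).gate_names a (mem_ids_tilde.2 (Or.inl ha)) hI⟩)

/-- A gate name of an earlier ideal protocol that is reserved for `Q̃` is the name of a gate of
`Q̃`. -/
theorem mem_ids_tilde_of_ideal {Q R : T.Node} {a : ℕ} (hlt : R < Q)
    (ha : a ∈ (T.I R).toComponent.ids) (h : a ∈ (T.tilde Q).names) :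
    a ∈ (T.tilde Q).toComponent.ids :=
  mem_ids_tilde.2 (Or.inr ⟨R,
    parent_eq_of_mem_names hT hlt ((hT.ideal R).id_mem_names ha) h, ha⟩)

theorem chan_id_notMem_ideal {Q : T.Node} {v : Reg} (hv : v ∈ (T.M Q).chan) :
    v.id ∉ (T.I Q).names :=
  (hT.ideal_for Q).chan_names v (mem_chan_tilde_of_mem hv)

/-- A channel of the module `R` whose name is reserved for `Q̃` is a channel of the main module. -/
theorem eq_of_chan_of_mem_tilde {Q R : T.Node} {v : Reg} (hv : v ∈ (T.M R).chan)
    (h : v.id ∈ (T.tilde Q).names) : R = Q := by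
  have hR := (hT.module R).chan_names v hv
  rcases owner_of_mem_names_tilde hT h with h | ⟨S, -, h, hI⟩
  · exact eq_of_mem_names hT hR h
  · obtain rfl := eq_of_mem_names hT hR h
    exact absurd hI (chan_id_notMem_ideal hT hv)

/-- A register of a role of the module `R` whose name is reserved for `Q̃` belongs to `M(Q)`, or is a
channel of `M(Q)` that is shared with the main module of a child. -/
theorem module_reg_cases {Q R : T.Node} {r : Role} {v : Reg} (hr : r ∈ (T.M R).roles)
    (hv : v ∈ r.regs) (h : v.id ∈ (T.tilde Q).names) :
    R = Q ∨ (T.parent R = some Q ∧ v ∈ (T.M R).io r) := by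
  rcases Protocol.reg_cases (P := T.M R) hv with hn | hc | hio
  · left
    rcases owner_of_mem_names_tilde hT h with h | ⟨S, -, h, hI⟩
    · exact eq_of_mem_names hT hn h
    · obtain rfl := eq_of_mem_names hT hn h
      exact absurd hI ((hT.ideal_for R).reg_names r (mem_roles_tilde.2 (Or.inl hr)) v hv)
  · exact absurd (mem_allNames_of_mem_tilde hT h) (hT.corr_names R r hr v hc).1
  · by_cases hR : R = T.root
    · subst hR
      exact absurd (mem_allNames_of_mem_tilde hT h) (hT.root_io r hr v hio)
    · obtain ⟨R', hR', -⟩ := T.parent_lt R hR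
      obtain rfl := eq_of_chan_of_mem_tilde hT (io_chan hT hR' hr hio).1 h
      exact Or.inr ⟨hR', hio⟩

/-- A register of a role of an earlier ideal protocol `I(R)` whose name is reserved for `Q̃` is only
used if `I(R)` is a part of `Q̃`. -/
theorem parent_eq_of_ideal_reg {Q R : T.Node} (hlt : R < Q) {r : Role} {v : Reg}
    (hr : r ∈ (T.I R).roles) (hv : v ∈ r.regs) (h : v.id ∈ (T.tilde Q).names) :
    T.parent R = some Q := by
  rcases Protocol.reg_cases (P := T.I R) hv with hn | hc | hio
  · exact parent_eq_of_mem_names hT hlt hn h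
  · exact absurd (mem_allNames_of_mem_tilde hT h) (ideal_corr_notMem hT hr hc)
  · obtain ⟨r', hr', -, hio'⟩ := module_io_of_ideal hT hr hio
    rcases module_reg_cases hT hr' hio'.1 h with rfl | ⟨hp, -⟩
    · exact absurd hlt (lt_irrefl _)
    · exact hp

end WellFormed

/-! ### Validity of the hybrid environments and of the composed simulator -/

section Validity

variable {σ E}
variable (hT : T.WellFormed) (hE : ValidEnv (T.sub T.root) E)
include hT hE

omit hT in
theorem env_id_notMem {g : Gate} (hg : g ∈ E.gates) : g.id ∉ T.allNames :=
  names_sub_root (T := T) ▸ hE.own_gates g hg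

/-- The access of the environment to the registers of `Q̃` is permitted. -/
theorem env_permitted (Q : T.Node) {g : Gate} (hg : g ∈ E.gates) {v : Reg} (hv : v ∈ g.regs)
    (h : v.id ∈ (T.tilde Q).names) : (T.tilde Q).Permits g v := by
  have hP := hE.permitted g hg v hv (names_sub_root (T := T) ▸ mem_allNames_of_mem_tilde hT h)
  rcases hP with hw | ⟨hw, hpres⟩ | ⟨r, hr, c, hc, hctrl, hvr⟩
  · obtain ⟨R, hR⟩ := mem_writable_sub_root.1 hw
    obtain rfl := eq_of_chan_of_mem_tilde hT ((hT.module R).types.2.1 hR) h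
    exact Or.inl (mem_writable_tilde.2 (Or.inl hR))
  · obtain ⟨R, hR⟩ := mem_readable_sub_root.1 hw
    obtain rfl := eq_of_chan_of_mem_tilde hT ((hT.module R).types.1 hR) h
    exact Or.inr (Or.inl ⟨mem_readable_tilde.2 (Or.inl hR), hpres⟩)
  · obtain ⟨R, hrR⟩ := mem_roles_sub_root.1 hr
    rcases module_reg_cases hT hrR hvr h with rfl | ⟨hp, hio⟩
    · exact Or.inr (Or.inr ⟨r, mem_roles_tilde.2 (Or.inl hrR), c, hc, hctrl, hvr⟩)
    -- The corrupted role lies in a child, which `Q̃` contains only in ideal form. Its ideal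
    -- counterpart has the same corruption bit and the same input/output channel, so it grants the
    -- same access.
    · obtain ⟨r', hr', hcorr, hio'⟩ := ideal_io_of_module hT hrR hio
      exact Or.inr (Or.inr ⟨r', mem_roles_tilde.2 (Or.inr ⟨R, hp, hr'⟩), c, hcorr.trans hc, hctrl,
        hio'.1⟩)

theorem env_order (Q : T.Node) {x : Finset ℕ} {a b d : ℕ} (hab : E.rel x a b)
    (hd : d = a ∨ d = b) (h : d ∈ (T.tilde Q).names) : d ∈ (T.tilde Q).toComponent.ids := by
  have hmem : d ∈ (T.sub T.root).names :=
    names_sub_root (T := T) ▸ mem_allNames_of_mem_tilde hT h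
  have hids : d ∈ (T.sub T.root).toComponent.ids := by
    rcases hd with rfl | rfl
    exacts [(hE.order x _ b hab).1 hmem, (hE.order x a _ hab).2 hmem]
  rw [toComponent_sub_root, Component.mem_ids_sum] at hids
  obtain ⟨R, -, hR⟩ := hids
  exact mem_ids_tilde_of_module hT hR h

theorem env_output (Q : T.Node) :
    E.Z.IsBit ∧ E.Z.id ∉ (T.tilde Q).names ∧ ∀ r ∈ (T.tilde Q).roles, E.Z ∉ r.regs := by
  obtain ⟨hbit, hname, hreg⟩ := hE.output
  rw [names_sub_root] at hname
  have hnoreg : ∀ R, ∀ r ∈ (T.M R).roles, E.Z ∉ r.regs :=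
    fun R r hr => hreg r (mem_roles_sub_root.2 ⟨R, hr⟩)
  refine ⟨hbit, fun h => hname (mem_allNames_of_mem_tilde hT h), fun r hr hZ => ?_⟩
  rcases mem_roles_tilde.1 hr with h | ⟨R, -, h⟩
  · exact hnoreg Q r h hZ
  · obtain ⟨R', r', hr', hZ'⟩ := module_reg_of_ideal hT h hZ
      fun hn => hname (mem_allNames (hT.ideal_names R hn))
    exact hnoreg R' r' hr' hZ'

omit hE in
-- The simulator's own registers and the corruption registers have no names in `Q̃`. What remains is
-- adversarial access to `I(R)`; if it touches `Q̃`, then `I(R)` is a part of `Q̃`, which inherits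
-- the permission.
theorem sim_permitted {Q R : T.Node} (hlt : R < Q) {F : Env} {S : Component}
    (hS : ValidSim (T.tilde R) (T.I R) F S) {g : Gate} (hg : g ∈ S.gates) {v : Reg}
    (hv : v ∈ g.regs) (h : v.id ∈ (T.tilde Q).names) : (T.tilde Q).Permits g v := by
  rcases hS.permitted g hg v hv with ⟨h1, h2⟩ | ⟨⟨r, hr, hc⟩, -⟩ | ⟨-, hP⟩
  · exact absurd h (notMem_tilde_of_sim hT hlt h1 h2)
  · obtain ⟨Q', r', hr', hc'⟩ := exists_module_corr_of_tilde hT hr hc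
    exact absurd (mem_allNames_of_mem_tilde hT h) (hT.corr_names Q' r' hr' v hc').1
  · rcases hP with hw | ⟨hw, hpres⟩ | ⟨r, hr, c, hc, hctrl, hvr⟩
    · have hn := (hT.ideal R).chan_names v ((hT.ideal R).types.2.1 hw)
      exact Or.inl (mem_writable_tilde.2 (Or.inr ⟨R, parent_eq_of_mem_names hT hlt hn h, hw⟩))
    · have hn := (hT.ideal R).chan_names v ((hT.ideal R).types.1 hw)
      exact Or.inr (Or.inl
        ⟨mem_readable_tilde.2 (Or.inr ⟨R, parent_eq_of_mem_names hT hlt hn h, hw⟩), hpres⟩)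
    · exact Or.inr (Or.inr ⟨r, mem_roles_tilde.2
        (Or.inr ⟨R, parent_eq_of_ideal_reg hT hlt hr hvr h, hr⟩), c, hc, hctrl, hvr⟩)

/-- A gate of the environment of an earlier `R̃` whose name is reserved for `Q̃` is a gate of a module
or an ideal protocol, and its name is that of a gate of `Q̃`. -/
theorem mem_ids_tilde_of_envAt {Q R : T.Node} (hlt : R < Q)
    (hS : ∀ R' < R, ValidSim (T.tilde R') (T.I R') (T.envAt σ E R') (σ R' (T.envAt σ E R')))
    {a : ℕ} (ha : a ∈ (T.envAt σ E R).ids) (h : a ∈ (T.tilde Q).names) :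
    a ∈ (T.tilde Q).toComponent.ids := by
  rcases (envAt_iff σ E (Component.additive_mem_ids a) R).1 ha with
    ha | ⟨R', -, ha⟩ | ⟨R', hR', -, ha⟩ | ⟨R', hR', ha⟩
  · obtain ⟨g, hg, rfl⟩ := Component.mem_ids.1 ha
    exact absurd (mem_allNames_of_mem_tilde hT h) (env_id_notMem hE hg)
  · exact mem_ids_tilde_of_module hT ha h
  · exact mem_ids_tilde_of_ideal hT (hR'.trans hlt) ha h
  · obtain ⟨g, hg, rfl⟩ := Component.mem_ids.1 ha
    have hown := (hS R' hR').own_gates g hg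
    exact absurd h (notMem_tilde_of_sim hT (hR'.trans hlt) hown.1 hown.2)

/-- The order relation of a simulator for an earlier `R̃` only concerns, among the names reserved for
`Q̃`, gates of `Q̃`. -/
theorem sim_order {Q R : T.Node} (hlt : R < Q)
    (hS : ∀ R' ≤ R, ValidSim (T.tilde R') (T.I R') (T.envAt σ E R') (σ R' (T.envAt σ E R')))
    {x : Finset ℕ} {a b d : ℕ} (hab : (σ R (T.envAt σ E R)).rel x a b) (hd : d = a ∨ d = b)
    (h : d ∈ (T.tilde Q).names) : d ∈ (T.tilde Q).toComponent.ids := by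
  obtain ⟨hcases, hI⟩ := (hS R le_rfl).order x a b hab d hd
  rcases hcases with hids | hids | hn
  · obtain ⟨g, hg, rfl⟩ := Component.mem_ids.1 hids
    have hown := (hS R le_rfl).own_gates g hg
    exact absurd h (notMem_tilde_of_sim hT hlt hown.1 hown.2)
  · exact mem_ids_tilde_of_envAt hT hE hlt (fun R' hR' => hS R' hR'.le) hids h
  · by_cases hdI : d ∈ (T.I R).names
    · exact mem_ids_tilde_of_ideal hT hlt (hI hdI) h
    · exact absurd h (notMem_tilde_of_sim hT hlt hn hdI)

omit hT in
-- No circuit condition is checked directly: the initial hybrid is a circuit because `E` is valid,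
-- and each later one because the simulator added just before is valid.
theorem hybrid_isCircuit (Q : T.Node)
    (hS : ∀ R < Q, ValidSim (T.tilde R) (T.I R) (T.envAt σ E R) (σ R (T.envAt σ E R))) :
    (T.hybrid σ E Q).IsCircuit := by
  obtain ⟨j, hj⟩ := Q
  cases j with
  | zero =>
    have h := hE.circuit
    rwa [← hybrid_zero σ] at h
  | succ j =>
    have h := (hS ⟨j, (Nat.lt_succ_self j).trans hj⟩ (Nat.lt_succ_self j)).circuit
    rwa [envAt_add_ideal] at h

/-- `E(Q̃)` is a valid environment for `Q̃`. -/
theorem envAt_valid (Q : T.Node)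
    (hS : ∀ R < Q, ValidSim (T.tilde R) (T.I R) (T.envAt σ E R) (σ R (T.envAt σ E R))) :
    ValidEnv (T.tilde Q) (T.envAt σ E Q) where
  output := env_output hT hE Q
  own_gates g hg := by
    rcases (envAt_iff σ E (Component.additive_mem_gates g) Q).1 hg with
      hg | ⟨R, hR, hg⟩ | ⟨R, hR, ⟨R', hR', hlt⟩, hg⟩ | ⟨R, hR, hg⟩
    · exact fun h => env_id_notMem hE hg (mem_allNames_of_mem_tilde hT h)
    · exact notMem_tilde_of_lt hT hR ((hT.module R).id_mem_names (Component.mem_ids_of_mem hg))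
    · exact notMem_tilde_of_ideal hT hR' hlt.ne' hR
        ((hT.ideal R).id_mem_names (Component.mem_ids_of_mem hg))
    · have hown := (hS R hR).own_gates g hg
      exact notMem_tilde_of_sim hT hR hown.1 hown.2
  permitted g hg v hv h := by
    rcases (envAt_iff σ E (Component.additive_mem_gates g) Q).1 hg with
      hg | ⟨R, hR, hg⟩ | ⟨R, hR, ⟨R', hR', hlt⟩, hg⟩ | ⟨R, hR, hg⟩
    · exact env_permitted hT hE Q hg hv h
    · obtain ⟨r, hr, hgr⟩ := Protocol.mem_gates_toComponent.1 hg
      have hvr := (((hT.module R).role_circuit r hr).2.1 g hgr).2 hv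
      rcases module_reg_cases hT hr hvr h with rfl | ⟨hp, -⟩
      · exact absurd hR (lt_irrefl _)
      · exact absurd hR (lt_of_parent hp).asymm
    · obtain ⟨r, hr, hgr⟩ := Protocol.mem_gates_toComponent.1 hg
      have hvr := (((hT.ideal R).role_circuit r hr).2.1 g hgr).2 hv
      have hp := parent_eq_of_ideal_reg hT hR hr hvr h
      rw [hR'] at hp
      cases hp
      exact absurd hlt (lt_irrefl _)
    · exact sim_permitted hT hR (hS R hR) hg hv h
  order x a b hab := by
    have key : ∀ d, d = a ∨ d = b → d ∈ (T.tilde Q).names → d ∈ (T.tilde Q).toComponent.ids := by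
      intro d hd h
      rcases (envAt_iff σ E (Component.additive_rel x a b) Q).1 hab with
        hab | ⟨R, hR, hab⟩ | ⟨R, hR, -, hab⟩ | ⟨R, hR, hab⟩
      · exact env_order hT hE Q hab hd h
      · exact mem_ids_tilde_of_module hT ((hT.module R).rel_mem_ids hab hd) h
      · exact mem_ids_tilde_of_ideal hT hR ((hT.ideal R).rel_mem_ids hab hd) h
      · exact sim_order hT hE hR (fun R' hR' => hS R' (hR'.trans_lt hR)) hab hd h
    exact ⟨key a (Or.inl rfl), key b (Or.inr rfl)⟩
  circuit := by
    rw [envAt_add_tilde]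
    exact hybrid_isCircuit hE Q hS

/-! ### The composed simulator. -/

omit hE in
theorem notMem_root_ideal_of_sim {R : T.Node} {a : ℕ} (ha : a ∈ (T.tilde R).names)
    (ha' : a ∉ (T.I R).names) : a ∉ (T.I T.root).names := by
  rcases (Fin.le_last R).eq_or_lt with rfl | hlt
  · exact ha'
  · exact fun h => notMem_tilde_of_sim hT hlt ha ha' (ideal_subset_tilde hT _ h)

omit hE in
theorem notMem_root_ideal_of_ideal {R : T.Node} (hlt : R < T.root) {a : ℕ}
    (ha : a ∈ (T.I R).names) : a ∉ (T.I T.root).names := fun h =>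
  hlt.ne (eq_of_mem_names hT (hT.ideal_names R ha) (hT.ideal_names _ h))

/-- The union of the simulators is a valid simulator for the whole protocol. -/
theorem simulators_valid
    (hS : ∀ R, ValidSim (T.tilde R) (T.I R) (T.envAt σ E R) (σ R (T.envAt σ E R))) :
    ValidSim (T.sub T.root) (T.I T.root) E (T.simulators σ E (T.k + 1)) where
  own_gates g hg := by
    obtain ⟨R, -, hg⟩ := (simulators_iff σ E (Component.additive_mem_gates g) _).1 hg
    have hown := (hS R).own_gates g hg
    rw [names_sub_root]
    exact ⟨mem_allNames_of_mem_tilde hT hown.1, notMem_root_ideal_of_sim hT hown.1 hown.2⟩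
  permitted g hg v hv := by
    obtain ⟨R, -, hg⟩ := (simulators_iff σ E (Component.additive_mem_gates g) _).1 hg
    rw [names_sub_root]
    rcases (hS R).permitted g hg v hv with ⟨h1, h2⟩ | ⟨⟨r, hr, hc⟩, hpres⟩ | ⟨hnc, hP⟩
    · exact Or.inl ⟨mem_allNames_of_mem_tilde hT h1, notMem_root_ideal_of_sim hT h1 h2⟩
    · obtain ⟨Q, r', hr', hc'⟩ := exists_module_corr_of_tilde hT hr hc
      exact Or.inr (Or.inl ⟨⟨r', Or.inl (mem_roles_sub_root.2 ⟨Q, hr'⟩), hc'⟩, hpres⟩)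
    rcases (Fin.le_last R).eq_or_lt with rfl | hlt
    -- Validity at the root node excludes only corruption registers of the root's `Q̃` and `I(P)`,
    -- whereas all those of `P` must be excluded. One accessed through `I(P)` would be input/output
    -- of `M(P)`, but a module role using it must have it as its corruption register.
    · refine Or.inr (Or.inr ⟨?_, hP⟩)
      rintro r (hr | hr) hc
      · obtain ⟨Q, hrQ⟩ := mem_roles_sub_root.1 hr
        obtain ⟨hname, huse⟩ := hT.corr_names Q r hrQ v hc
        have hnI : v.id ∉ (T.I T.root).names := fun h =>
          hname (mem_allNames (hT.ideal_names _ h))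
        rcases hP with hw | ⟨hw, -⟩ | ⟨r₁, hr₁, c, -, -, hvr⟩
        · exact hnI ((hT.ideal _).chan_names v ((hT.ideal _).types.2.1 hw))
        · exact hnI ((hT.ideal _).chan_names v ((hT.ideal _).types.1 hw))
        · obtain ⟨r₀, hr₀, -, hio⟩ := module_io_of_ideal hT hr₁
            ⟨hvr, hnI, hnc r₁ (Or.inr hr₁)⟩
          exact hio.2.2 (huse _ r₀ hr₀ hio.1)
      · exact hnc r (Or.inr hr) hc
    -- Below the root, registers of `I(R)` count as the composed simulator's own: they are internal
    -- to `I(R)` or channels of its caller. Even if the caller is the root, channel names avoid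
    -- those of `I(P)`.
    · have hin : v.id ∈ (T.I R).names → v.id ∈ T.allNames ∧ v.id ∉ (T.I T.root).names :=
        fun h => ⟨mem_allNames (hT.ideal_names R h), notMem_root_ideal_of_ideal hT hlt h⟩
      left
      rcases hP with hw | ⟨hw, -⟩ | ⟨r, hr, c, -, -, hvr⟩
      · exact hin ((hT.ideal R).chan_names v ((hT.ideal R).types.2.1 hw))
      · exact hin ((hT.ideal R).chan_names v ((hT.ideal R).types.1 hw))
      · rcases Protocol.reg_cases (P := T.I R) hvr with hn | hc | hio
        · exact hin hn
        · exact absurd hc (hnc r (Or.inr hr))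
        · obtain ⟨r', hr', -, hio'⟩ := module_io_of_ideal hT hr hio
          obtain ⟨R', hR', -⟩ := exists_parent hlt
          obtain ⟨hch, hname⟩ := io_chan hT hR' hr' hio'
          refine ⟨mem_allNames hname, fun h => ?_⟩
          obtain rfl := eq_of_mem_names hT hname (hT.ideal_names _ h)
          exact chan_id_notMem_ideal hT hch h
  order x a b hab d hd := by
    obtain ⟨R, hR, hab⟩ := (simulators_iff σ E (Component.additive_rel x a b) _).1 hab
    obtain ⟨hcases, hI⟩ := (hS R).order x a b hab d hd
    rw [names_sub_root]
    refine ⟨?_, fun h => ?_⟩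
    · rcases hcases with hids | hids | hn
      · exact Or.inl ((simulators_iff σ E (Component.additive_mem_ids d) _).2 ⟨R, hR, hids⟩)
      · rcases (envAt_iff σ E (Component.additive_mem_ids d) R).1 hids with
          h | ⟨R', -, h⟩ | ⟨R', -, -, h⟩ | ⟨R', hR', h⟩
        · exact Or.inr (Or.inl h)
        · exact Or.inr (Or.inr (mem_allNames ((hT.module R').id_mem_names h)))
        · exact Or.inr (Or.inr (mem_allNames (hT.ideal_names R' ((hT.ideal R').id_mem_names h))))
        · exact Or.inl ((simulators_iff σ E (Component.additive_mem_ids d) _).2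
            ⟨R', R'.isLt, h⟩)
      · exact Or.inr (Or.inr (mem_allNames_of_mem_tilde hT hn))
    · rcases (Fin.le_last R).eq_or_lt with rfl | hlt
      · exact hI h
      -- An earlier simulator can order such a name only if it is that of a gate of the root's `Q̃`;
      -- sharing it with `I(P)` is then allowed only for an actual ideal gate.
      · exact (hT.ideal_for T.root).gate_names d
          (sim_order hT hE hlt (fun R' _ => hS R') hab hd (ideal_subset_tilde hT _ h)) h
  circuit := by
    rw [← hybrid_last]
    have h := (hS T.root).circuit
    rwa [envAt_add_ideal] at h

/-! ### Induction along the traversal and telescoping. -/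

/-- Validity of `E(Q̃)` depends only on the simulators of earlier nodes, so strong induction
resolves the mutual dependence of environments and simulators. -/
theorem sim_valid {ε : T.Node → Env → ℝ}
    (hσ : ∀ Q, Simulates (T.tilde Q) (T.I Q) (ε Q) (σ Q)) (Q : T.Node) :
    ValidSim (T.tilde Q) (T.I Q) (T.envAt σ E Q) (σ Q (T.envAt σ E Q)) := by
  induction Q using WellFoundedLT.induction with
  | ind Q ih => exact (hσ Q _ (envAt_valid hT hE Q ih)).1

/-- The error of the composed simulator is at most the sum of the errors for the `Q̃`. -/
theorem advantage_simulators_le {ε : T.Node → Env → ℝ}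
    (hσ : ∀ Q, Simulates (T.tilde Q) (T.I Q) (ε Q) (σ Q)) :
    advantage (T.sub T.root) (T.I T.root) E (T.simulators σ E (T.k + 1)) ≤
      ∑ Q, ε Q (T.envAt σ E Q) := by
  have hstep : ∀ Q : T.Node, |(T.hybrid σ E Q).probZero E.Z -
      (T.hybrid σ E (Q + 1)).probZero E.Z| ≤ ε Q (T.envAt σ E Q) := by
    intro Q
    have h := (hσ Q _ (envAt_valid hT hE Q fun R _ => sim_valid hT hE hσ R)).2
    rwa [advantage, envAt_add_tilde, envAt_add_ideal] at h
  rw [advantage, ← hybrid_zero σ, ← hybrid_last, ← Finset.sum_range_sub'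
    (fun j => (T.hybrid σ E j).probZero E.Z), ← Fin.sum_univ_eq_sum_range
    (fun j => (T.hybrid σ E j).probZero E.Z - (T.hybrid σ E (j + 1)).probZero E.Z)]
  exact (Finset.abs_sum_le_sum_abs _ _).trans (Finset.sum_le_sum fun Q _ => hstep Q)

end Validity

end ProtocolTree

/-- If `P` securely realizes `I`, a simulator can be chosen as a function of the environment. -/
theorem SecurelyRealizes.exists_simulates {P I : Protocol} {ε : Env → ℝ}
    (h : SecurelyRealizes P I ε) : ∃ σ, Simulates P I ε σ := by
  -- On an invalid environment the chosen simulator is an arbitrary component, on which `Simulates`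
  -- imposes nothing.
  choose! σ hσ using h
  exact ⟨σ, hσ⟩

/-- Here `T n` is the protocol `P` for the value `n` of the security parameter, with its tree of
sub-protocols `Q`, and `ε n Q` is the error of `Q̃` as a function of the environment. If every `Q̃`
securely realizes `I(Q)`, then simulators for the `Q̃` can be chosen as functions of the environment,
and, whatever the choice, `P` securely realizes `I(P)` with error `∑ Q, ε n Q (E(Q̃))`, where `E(Q̃)`
is determined by `E`, `P` and the chosen simulators of the sub-protocols visited before `Q`. -/
theorem theorem2 (T : ℕ → ProtocolTree) (hT : ∀ n, (T n).WellFormed)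
    (ε : (n : ℕ) → (T n).Node → Env → ℝ)
    (h : ∀ n Q, SecurelyRealizes ((T n).tilde Q) ((T n).I Q) (ε n Q)) :
    (∃ σ : (n : ℕ) → (T n).Node → Env → Component,
      ∀ n Q, Simulates ((T n).tilde Q) ((T n).I Q) (ε n Q) (σ n Q)) ∧
    ∀ σ : (n : ℕ) → (T n).Node → Env → Component,
      (∀ n Q, Simulates ((T n).tilde Q) ((T n).I Q) (ε n Q) (σ n Q)) →
      ∀ n, SecurelyRealizes ((T n).sub (T n).root) ((T n).I (T n).root)
        (fun E => ∑ Q, ε n Q ((T n).envAt (σ n) E Q)) := by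
  refine ⟨?_, fun σ hσ n E hE => ⟨(T n).simulators (σ n) E ((T n).k + 1), ?_, ?_⟩⟩
  · choose σ hσ using fun n Q => (h n Q).exists_simulates
    exact ⟨σ, hσ⟩
  · exact ProtocolTree.simulators_valid (hT n) hE
      (ProtocolTree.sim_valid (hT n) hE (hσ n))
  · exact ProtocolTree.advantage_simulators_le (hT n) hE (hσ n)
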